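/- Let $\mathfrak H$ be a complex Hilbert space with inner product $(\cdot,\cdot)$, let $J$ be a bounded operator on $\mathfrak H$ with $J=J^*$ and $J^2=I$, and put $[f,g]=(Jf,g)$. A closed subspace $\mathfrak L$ is called positive (negative) if $[f,f]>0$ ($[f,f]<0$) for all nonzero $f\in\mathfrak L$; it is called maximal positive (maximal negative) if it is not a proper subspace of another positive (negative) subspace. Subspaces $\mathfrak L,\mathfrak M$ are $J$-orthogonal if $[f,g]=0$ for all $f\in\mathfrak L$, $g\in\mathfrak M$. Let $H$ be a $J$-symmetric operator in $\mathfrak H$, that is, $[Hf,g]=[f,Hg]$ for all $f,g\in D(H)$, and let $\{f_n\}$ be a family of eigenvectors of $H$ with pairwise distinct real eigenvalues $\{\lambda_n\}$ whose linear span is dense in $\mathfrak H$. Let $\mathfrak L_+^0$ and $\mathfrak L_-^0$ be the closed linear spans of $\{f_n : [f_n,f_n]>0\}$ and of $\{f_n : [f_n,f_n]<0\}$; their sum is direct. For a direct sum $\mathfrak L_+\dot+\mathfrak L_-$ let $\mathcal C_{\mathfrak L_+,\mathfrak L_-}$ be the operator with domain $\mathfrak L_+\dot+\mathfrak L_-$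 given by $\mathcal C_{\mathfrak L_+,\mathfrak L_-}(f_++f_-)=f_+-f_-$ for $f_\pm\in\mathfrak L_\pm$, and let $G_0=J\,\mathcal C_{\mathfrak L_+^0,\mathfrak L_-^0}$. Then the map $(\mathfrak L_+,\mathfrak L_-)\mapsto G=J\,\mathcal C_{\mathfrak L_+,\mathfrak L_-}$ is a bijection from the set of all pairs of $J$-orthogonal subspaces $\mathfrak L_\pm\supseteq\mathfrak L_\pm^0$ such that $\mathfrak L_+$ is maximal positive and $\mathfrak L_-$ is maximal negative onto the set of all self-adjoint extensions $G$ of $G_0$ that are positive, i.e. $(Gf,f)>0$ for all nonzero $f\in D(G)$, and satisfy $JGJGf=f$ for all $f\in D(G)$ (in particular $JGf\in D(G)$). The inverse map is given by $\mathfrak L_\pm=\tfrac12(I\pm JG)D(G)$. -/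

import Mathlib

namespace KreinC

noncomputable section

variable {E : Type*} [NormedAddCommGroup E] [InnerProductSpace ℂ E]

/-- The indefinite inner product `[f, g] = (J f, g)`. With `(·, ·)` linear in its
first argument, `(f, g)` is Mathlib's `inner ℂ g f`. -/
def form (J : E →L[ℂ] E) (f g : E) : ℂ := inner ℂ g (J f)

/-- `J` is a fundamental symmetry: `J = J*` and `J² = I`. -/
structure IsFundamentalSymmetry [CompleteSpace E] (J : E →L[ℂ] E) : Prop where
  selfAdjoint : IsSelfAdjoint J
  sq_eq_id : J ∘L J = ContinuousLinearMap.id ℂ E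

/-- A `J`-symmetric operator: `[A f, g] = [f, A g]` for all `f, g ∈ D(A)`. -/
def IsJSymmetric (J : E →L[ℂ] E) (A : E →ₗ.[ℂ] E) : Prop :=
  ∀ f g : A.domain, form J (A f) (g : E) = form J (f : E) (A g)

/-- A positive subspace: closed, with `[f, f] > 0` for its nonzero elements. -/
structure IsPositiveSubspace (J : E →L[ℂ] E) (L : Submodule ℂ E) : Prop where
  isClosed : IsClosed (L : Set E)
  pos : ∀ f ∈ L, f ≠ 0 → 0 < (form J f f).re

/-- A negative subspace: closed, with `[f, f] < 0` for its nonzero elements. -/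
structure IsNegativeSubspace (J : E →L[ℂ] E) (L : Submodule ℂ E) : Prop where
  isClosed : IsClosed (L : Set E)
  neg : ∀ f ∈ L, f ≠ 0 → (form J f f).re < 0

/-- `J`-orthogonality of two subspaces. -/
def JOrthogonal (J : E →L[ℂ] E) (L M : Submodule ℂ E) : Prop :=
  ∀ f ∈ L, ∀ g ∈ M, form J f g = 0

/-- The graph `{(p + m, p - m) : p ∈ L₊, m ∈ L₋}`. -/
def cGraph (Lp Lm : Submodule ℂ E) : Submodule ℂ (E × E) :=
  (Lp.prod Lm).map
    ((LinearMap.fst ℂ E E + LinearMap.snd ℂ E E).prod (LinearMap.fst ℂ E E - LinearMap.snd ℂ E E))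

/-- The operator `C` associated with a direct sum `L₊ ∔ L₋`: its domain is `L₊ + L₋`, and
`C (p + m) = p - m` for `p ∈ L₊`, `m ∈ L₋`. -/
def cOp (Lp Lm : Submodule ℂ E) : E →ₗ.[ℂ] E := (cGraph Lp Lm).toLinearPMap

/-- The operator `G = J C`, with domain `D(C) = L₊ + L₋`. -/
def gOp (J : E →L[ℂ] E) (Lp Lm : Submodule ℂ E) : E →ₗ.[ℂ] E :=
  (J : E →ₗ[ℂ] E).compPMap (cOp Lp Lm)

theorem mem_cGraph_iff {Lp Lm : Submodule ℂ E} {x : E × E} :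
    x ∈ cGraph Lp Lm ↔ ∃ p ∈ Lp, ∃ m ∈ Lm, p + m = x.1 ∧ p - m = x.2 := by
  simp only [cGraph, Submodule.mem_map, Submodule.mem_prod, Prod.exists, LinearMap.prod_apply,
    Prod.ext_iff]
  constructor
  · rintro ⟨p, m, ⟨hp, hm⟩, h⟩
    exact ⟨p, hp, m, hm, h⟩
  · rintro ⟨p, hp, m, hm, h⟩
    exact ⟨p, m, ⟨hp, hm⟩, h⟩

/-- If the sum is direct, `cGraph` is the graph of `C`. -/
theorem cOp_graph {Lp Lm : Submodule ℂ E} (h : Disjoint Lp Lm) :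
    (cOp Lp Lm).graph = cGraph Lp Lm := by
  refine Submodule.toLinearPMap_graph_eq _ ?_
  intro x hx hx1
  obtain ⟨p, hp, m, hm, h1, h2⟩ := mem_cGraph_iff.1 hx
  rw [hx1] at h1
  have hpm : p = -m := eq_neg_of_add_eq_zero_left h1
  have hp0 : p = 0 := Submodule.disjoint_def.1 h p hp (hpm ▸ Lm.neg_mem hm)
  have hm0 : m = 0 := by simpa [hp0] using hpm.symm
  rw [← h2, hp0, hm0, sub_zero]

/-- The domain of `C` is `L₊ + L₋`. -/
theorem cOp_domain (Lp Lm : Submodule ℂ E) : (cOp Lp Lm).domain = Lp ⊔ Lm := by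
  ext x
  simp only [cOp, Submodule.toLinearPMap_domain, Submodule.mem_map, Submodule.mem_sup,
    LinearMap.fst_apply]
  constructor
  · rintro ⟨y, hy, rfl⟩
    obtain ⟨p, hp, m, hm, h1, -⟩ := mem_cGraph_iff.1 hy
    exact ⟨p, hp, m, hm, h1⟩
  · rintro ⟨p, hp, m, hm, h1⟩
    exact ⟨(x, p - m), mem_cGraph_iff.2 ⟨p, hp, m, hm, h1, rfl⟩, rfl⟩

/-- The defining formula of `C`. -/
theorem cOp_apply {Lp Lm : Submodule ℂ E} (h : Disjoint Lp Lm) {p m : E} (hp : p ∈ Lp)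
    (hm : m ∈ Lm) (hpm : p + m ∈ (cOp Lp Lm).domain) : cOp Lp Lm ⟨p + m, hpm⟩ = p - m := by
  have h1 : (p + m, p - m) ∈ (cOp Lp Lm).graph := by
    rw [cOp_graph h]
    exact mem_cGraph_iff.2 ⟨p, hp, m, hm, rfl, rfl⟩
  exact (cOp Lp Lm).mem_graph_snd_inj ((cOp Lp Lm).mem_graph _) h1 rfl

/-- The closed linear span of those vectors `e n` for which `[e n, e n] > 0`. -/
def posSpan {ι : Type*} (J : E →L[ℂ] E) (e : ι → E) : Submodule ℂ E :=
  (Submodule.span ℂ {x | ∃ n, x = e n ∧ 0 < (form J (e n) (e n)).re}).topologicalClosure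

/-- The closed linear span of those vectors `e n` for which `[e n, e n] < 0`. -/
def negSpan {ι : Type*} (J : E →L[ℂ] E) (e : ι → E) : Submodule ℂ E :=
  (Submodule.span ℂ {x | ∃ n, x = e n ∧ (form J (e n) (e n)).re < 0}).topologicalClosure

/-- Eigenvectors of a `J`-symmetric operator for distinct real eigenvalues are `J`-orthogonal. -/
theorem form_eigenvectors_eq_zero {J : E →L[ℂ] E} {A : E →ₗ.[ℂ] E} (hA : IsJSymmetric J A)
    {a b : ℝ} (hab : a ≠ b) {x y : A.domain} (hx : A x = (a : ℂ) • (x : E))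
    (hy : A y = (b : ℂ) • (y : E)) : form J (x : E) (y : E) = 0 := by
  have h := hA x y
  rw [hx, hy] at h
  simp only [form, map_smul, inner_smul_right, inner_smul_left, Complex.conj_ofReal] at h
  have h2 : ((a : ℂ) - b) * inner ℂ (y : E) (J x) = 0 := by rw [sub_mul, h, sub_self]
  rcases mul_eq_zero.1 h2 with h3 | h3
  · exact absurd (by exact_mod_cast sub_eq_zero.1 h3) hab
  · exact h3

/-- If `[v, y] = 0` for all `v ∈ s`, then the same holds on the closed linear span of `s`. -/
theorem form_eq_zero_of_mem_closure {J : E →L[ℂ] E} {s : Set E} {y : E}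
    (h : ∀ v ∈ s, form J v y = 0) {x : E}
    (hx : x ∈ (Submodule.span ℂ s).topologicalClosure) : form J x y = 0 := by
  have h1 : Submodule.span ℂ s ≤ ((innerSL ℂ y) ∘L J).ker :=
    Submodule.span_le.2 fun v hv => h v hv
  exact Submodule.topologicalClosure_minimal _ h1 (ContinuousLinearMap.isClosed_ker _) hx

/-- For a complete set of eigenvectors of a `J`-symmetric operator with distinct real eigenvalues,
the sum of `posSpan` and `negSpan` is direct, so that `cOp` is given on it by `cOp_apply`. -/
theorem disjoint_posSpan_negSpan [CompleteSpace E] {J : E →L[ℂ] E}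
    (hJ : IsFundamentalSymmetry J) {A : E →ₗ.[ℂ] E} (hA : IsJSymmetric J A) {ι : Type*}
    {lam : ι → ℝ} (hlam : Function.Injective lam) {e : ι → A.domain}
    (heig : ∀ n, A (e n) = (lam n : ℂ) • (e n : E))
    (hcomplete : Dense (Submodule.span ℂ (Set.range fun n => (e n : E)) : Set E)) :
    Disjoint (posSpan J fun n => (e n : E)) (negSpan J fun n => (e n : E)) := by
  rw [Submodule.disjoint_def]
  intro x hp hm
  have key : ∀ n, form J x (e n : E) = 0 := by
    intro n
    have orth : ∀ k, k ≠ n → form J (e k : E) (e n : E) = 0 := fun k hk =>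
      form_eigenvectors_eq_zero hA (fun h => hk (hlam h)) (heig k) (heig n)
    by_cases hn : 0 < (form J (e n : E) (e n : E)).re
    · refine form_eq_zero_of_mem_closure ?_ hm
      rintro v ⟨k, rfl, hk⟩
      exact orth k fun h => (lt_asymm hn) (h ▸ hk)
    · refine form_eq_zero_of_mem_closure ?_ hp
      rintro v ⟨k, rfl, hk⟩
      exact orth k fun h => hn (h ▸ hk)
  have h0 : J x = 0 := by
    refine hcomplete.eq_zero_of_inner_right ℂ fun v hv => ?_
    have h1 : Submodule.span ℂ (Set.range fun n => (e n : E)) ≤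
        (innerSL ℂ (J x)).ker := by
      refine Submodule.span_le.2 ?_
      rintro _ ⟨n, rfl⟩
      exact inner_eq_zero_symm.1 (key n)
    exact inner_eq_zero_symm.1 (h1 hv)
  have h2 := congrArg (fun B : E →L[ℂ] E => B x) hJ.sq_eq_id
  simpa [h0] using h2.symm

/-- The extensions of `(L₊⁰, L₋⁰)` to pairs `(L₊, L₋)` of `J`-orthogonal subspaces that are maximal
positive and maximal negative, respectively. -/
def maximalExtensions (J : E →L[ℂ] E) (Lp0 Lm0 : Submodule ℂ E) :
    Set (Submodule ℂ E × Submodule ℂ E) :=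
  {L | Lp0 ≤ L.1 ∧ Lm0 ≤ L.2 ∧ Maximal (IsPositiveSubspace J) L.1 ∧
    Maximal (IsNegativeSubspace J) L.2 ∧ JOrthogonal J L.1 L.2}

/-- A positive operator: `(G f, f) > 0` for all nonzero `f ∈ D(G)`. -/
def IsPositiveOperator (G : E →ₗ.[ℂ] E) : Prop :=
  ∀ f : G.domain, (f : E) ≠ 0 → 0 < (inner ℂ (f : E) (G f)).re

/-- `J G J G f = f` for all `f ∈ D(G)`; in particular `J G f ∈ D(G)`. -/
def SatisfiesJGJG (J : E →L[ℂ] E) (G : E →ₗ.[ℂ] E) : Prop :=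
  ∀ f : G.domain, ∃ h : J (G f) ∈ G.domain, J (G ⟨J (G f), h⟩) = f

/-- The positive self-adjoint extensions `G` of `G₀` that satisfy `J G J G f = f` on `D(G)`. -/
def positiveExtensions [CompleteSpace E] (J : E →L[ℂ] E) (G0 : E →ₗ.[ℂ] E) : Set (E →ₗ.[ℂ] E) :=
  {G | G0 ≤ G ∧ IsSelfAdjoint G ∧ IsPositiveOperator G ∧ SatisfiesJGJG J G}

/-- The pair `(½ (I + J G) D(G), ½ (I - J G) D(G))`. -/
def rangePair (J : E →L[ℂ] E) (G : E →ₗ.[ℂ] E) : Submodule ℂ E × Submodule ℂ E :=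
  (LinearMap.range ((1 / 2 : ℂ) • (G.domain.subtype + (J : E →ₗ[ℂ] E) ∘ₗ G.toFun)),
   LinearMap.range ((1 / 2 : ℂ) • (G.domain.subtype - (J : E →ₗ[ℂ] E) ∘ₗ G.toFun)))

end

end KreinC

namespace KreinC

open ComplexConjugate

variable {E : Type*} [NormedAddCommGroup E] [InnerProductSpace ℂ E]

/-! A pair of subspaces with direct sum is the same as an involution on that sum: `C` is recovered
from its eigenspaces for the eigenvalues ±1, and conversely. Since `J G = C`, the condition `J G J G
f = f` says exactly that `J G` is an involution of `D(G)`, and `rangePair` returns its eigenspaces.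
What remains is to match the geometry of the pair with the analysis of `G`.

The bridge is a test for maximality (`maximal_isPositiveSubspace_iff`): a positive subspace is
maximal iff no nonzero `u` with `J u = u` is J-orthogonal to it; for negative subspaces replace `J`
by `-J`.

From pairs to operators, the test shows that each of two J-orthogonal maximal subspaces contains the
J-orthogonal complement of the other (`mem_of_form_eq_zero`). This gives a dense domain and `D(G*) ⊆
D(G)`. From operators to pairs, the eigenspaces are closed because `G` is closed, J-orthogonal
because `G` is symmetric, and pass the test because `D(G*) ⊆ D(G)`.

The eigenvectors enter only through the directness of `L₊⁰ + L₋⁰`, which makes `G₀` given by its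
formula. -/

theorem form_add_left (J : E →L[ℂ] E) (f g h : E) : form J (f + g) h = form J f h + form J g h := by
  simp [form]

theorem form_sub_left (J : E →L[ℂ] E) (f g h : E) : form J (f - g) h = form J f h - form J g h := by
  simp [form]

theorem form_add_right (J : E →L[ℂ] E) (f g h : E) : form J f (g + h) = form J f g + form J f h := by
  simp [form]

theorem form_sub_right (J : E →L[ℂ] E) (f g h : E) : form J f (g - h) = form J f g - form J f h := by
  simp [form]

theorem form_neg_operator (J : E →L[ℂ] E) (f g : E) : form (-J) f g = -form J f g := by
  simp [form]

/-! ### Definite vectors and subspaces, and the sign change `J ↦ -J`. -/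

variable {J : E →L[ℂ] E}

theorem form_self_re_of_apply_eq {u : E} (hu : J u = u) : (form J u u).re = ‖u‖ ^ 2 := by
  rw [form, hu]
  exact inner_self_eq_norm_sq (𝕜 := ℂ) u

theorem form_self_re_of_apply_eq_neg {u : E} (hu : J u = -u) : (form J u u).re = -‖u‖ ^ 2 := by
  rw [form, hu, inner_neg_right, Complex.neg_re]
  exact congrArg _ (inner_self_eq_norm_sq (𝕜 := ℂ) u)

theorem IsPositiveSubspace.nonneg {L : Submodule ℂ E} (hL : IsPositiveSubspace J L) {f : E}
    (hf : f ∈ L) : 0 ≤ (form J f f).re := by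
  rcases eq_or_ne f 0 with rfl | h
  · simp [form]
  · exact (hL.pos f hf h).le

theorem IsPositiveSubspace.eq_zero {L : Submodule ℂ E} (hL : IsPositiveSubspace J L) {f : E}
    (hf : f ∈ L) (h : (form J f f).re ≤ 0) : f = 0 :=
  by_contra fun h0 => (hL.pos f hf h0).not_ge h

theorem isPositiveSubspace_neg_iff {L : Submodule ℂ E} :
    IsPositiveSubspace (-J) L ↔ IsNegativeSubspace J L := by
  constructor
  · intro h
    exact ⟨h.isClosed, fun f hf h0 => by simpa [form_neg_operator] using h.pos f hf h0⟩
  · intro h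
    exact ⟨h.isClosed, fun f hf h0 => by simpa [form_neg_operator] using h.neg f hf h0⟩

theorem isPositiveSubspace_neg : IsPositiveSubspace (-J) = IsNegativeSubspace J := by
  ext L
  exact isPositiveSubspace_neg_iff

theorem JOrthogonal.neg {L M : Submodule ℂ E} (h : JOrthogonal J L M) : JOrthogonal (-J) L M :=
  fun f hf g hg => by rw [form_neg_operator, h f hf g hg, neg_zero]

theorem disjoint_of_isPositiveSubspace_of_isNegativeSubspace {Lp Lm : Submodule ℂ E}
    (hp : IsPositiveSubspace J Lp) (hm : IsNegativeSubspace J Lm) : Disjoint Lp Lm := by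
  rw [Submodule.disjoint_def]
  exact fun x hxp hxm => by_contra fun h0 => lt_asymm (hp.pos x hxp h0) (hm.neg x hxm h0)

/-! ### Maximal definite subspaces. -/

section FundamentalSymmetry

variable [CompleteSpace E]

theorem IsFundamentalSymmetry.apply_apply (hJ : IsFundamentalSymmetry J) (x : E) : J (J x) = x :=
  congrArg (fun B : E →L[ℂ] E => B x) hJ.sq_eq_id

theorem IsFundamentalSymmetry.inner_apply_left (hJ : IsFundamentalSymmetry J) (x y : E) :
    inner ℂ (J x) y = inner ℂ x (J y) :=
  hJ.selfAdjoint.isSymmetric x y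

theorem IsFundamentalSymmetry.neg (hJ : IsFundamentalSymmetry J) : IsFundamentalSymmetry (-J) :=
  ⟨hJ.selfAdjoint.neg, by ext x; simp [hJ.apply_apply]⟩

theorem IsFundamentalSymmetry.norm_apply (hJ : IsFundamentalSymmetry J) (x : E) : ‖J x‖ = ‖x‖ := by
  have h : ‖J x‖ ^ 2 = ‖x‖ ^ 2 := by
    rw [← inner_self_eq_norm_sq (𝕜 := ℂ), ← inner_self_eq_norm_sq (𝕜 := ℂ),
      hJ.inner_apply_left, hJ.apply_apply]
  exact (pow_left_inj₀ (norm_nonneg _) (norm_nonneg _) two_ne_zero).1 h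

theorem IsFundamentalSymmetry.conj_form (hJ : IsFundamentalSymmetry J) (f g : E) :
    conj (form J f g) = form J g f := by
  rw [form, form, inner_conj_symm, hJ.inner_apply_left]

theorem IsFundamentalSymmetry.form_eq_zero_comm (hJ : IsFundamentalSymmetry J) {f g : E}
    (h : form J f g = 0) : form J g f = 0 := by
  rw [← hJ.conj_form, h, map_zero]

theorem JOrthogonal.symm {L M : Submodule ℂ E} (hJ : IsFundamentalSymmetry J)
    (h : JOrthogonal J L M) : JOrthogonal J M L :=
  fun f hf g hg => hJ.form_eq_zero_comm (h g hg f hf)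

/-- The projection of a positive subspace to `ker (J - 1)` is closed. -/
theorem IsPositiveSubspace.isClosed_map (hJ : IsFundamentalSymmetry J) {L : Submodule ℂ E}
    (hL : IsPositiveSubspace J L) :
    IsClosed ((L.map ((ContinuousLinearMap.id ℂ E + J : E →L[ℂ] E) : E →ₗ[ℂ] E) :
      Submodule ℂ E) : Set E) := by
  -- On `L`, `‖x + J x‖² = 2‖x‖² + 2[x, x] ≥ 2‖x‖²`, so `I + J` is bounded below there and carries
  -- the complete space `L` onto a closed set.
  have hbound : ∀ x : L, ‖x‖ ≤ (1 : NNReal) *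
      ‖((ContinuousLinearMap.id ℂ E + J : E →L[ℂ] E) ∘L L.subtypeL) x‖ := by
    intro x
    have h1 : ‖(x : E) + J x‖ ^ 2 = 2 * ‖(x : E)‖ ^ 2 + 2 * (form J (x : E) x).re := by
      have := norm_add_sq (𝕜 := ℂ) (x : E) (J x)
      rw [this, hJ.norm_apply]
      simp only [form, RCLike.re_to_complex]
      ring
    have h2 := hL.nonneg x.2
    have h3 : ‖(x : E)‖ ≤ ‖(x : E) + J x‖ := by
      refine le_of_sq_le_sq ?_ (norm_nonneg _)
      nlinarith [sq_nonneg ‖(x : E)‖]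
    simpa using h3
  have hanti := ContinuousLinearMap.antilipschitz_of_bound _ hbound
  have : CompleteSpace L := hL.isClosed.completeSpace_coe
  have hclosed := hanti.isClosed_range (ContinuousLinearMap.uniformContinuous _)
  convert hclosed using 1
  ext y
  simp

/-- A positive subspace to which no nonzero `u ∈ ker (J - 1)` is `J`-orthogonal projects onto
`ker (J - 1)` along `ker (J + 1)`. -/
theorem IsPositiveSubspace.exists_sub_apply_eq_neg (hJ : IsFundamentalSymmetry J)
    {L : Submodule ℂ E} (hL : IsPositiveSubspace J L)
    (h : ∀ u, J u = u → (∀ p ∈ L, form J p u = 0) → u = 0) (x : E) :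
    ∃ p ∈ L, J (x - p) = -(x - p) := by
  set K : Submodule ℂ E :=
    L.map ((ContinuousLinearMap.id ℂ E + J : E →L[ℂ] E) : E →ₗ[ℂ] E) with hK
  have : CompleteSpace K := (hL.isClosed_map hJ).completeSpace_coe
  -- Both `(I + J) x` and its projection `q` to `K` are fixed by `J`, hence so is the remainder `u`.
  obtain ⟨q, hq, u, hu, hqu⟩ := K.exists_add_mem_mem_orthogonal (x + J x)
  obtain ⟨p, hp, hpq⟩ := hq
  have hpq' : p + J p = q := by simpa using hpq
  have hJu : J u = u := by
    have h1 := congrArg J hqu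
    rw [← hpq'] at h1 hqu
    simp only [map_add, hJ.apply_apply] at h1
    have h2 : J u = (J x + x) - (J p + p) := by rw [h1]; abel
    have h3 : u = (x + J x) - (p + J p) := by rw [hqu]; abel
    exact h2.trans ((by abel : _ = (x + J x) - (p + J p)).trans h3.symm)
  have hu0 : u = 0 := by
    refine h u hJu fun r hr => ?_
    have h1 : inner ℂ u (r + J r) = 0 :=
      (Submodule.mem_orthogonal' _ _).1 hu _ ⟨r, hr, by simp⟩
    rw [inner_add_right] at h1
    -- As `J u = u`, orthogonality of `u` to `(I + J) L` is J-orthogonality to `L`.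
    have h2 : inner ℂ u (J r) = inner ℂ u r := by rw [← hJ.inner_apply_left, hJu]
    rw [← h2, ← two_mul] at h1
    exact (mul_eq_zero.1 h1).resolve_left two_ne_zero
  refine ⟨p, hp, ?_⟩
  rw [hu0, ← hpq', add_zero] at hqu
  rw [map_sub, eq_neg_iff_add_eq_zero]
  have h1 : J x - J p + (x - p) = (x + J x) - (p + J p) := by abel
  rw [h1, hqu, sub_self]

/-- A nonzero `u` violating the condition could be adjoined to `L`. If there is none, any `x` in a
larger positive `M` differs from some `p ∈ L` by a vector of `ker (J + 1)`; this difference lies in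
`M` and satisfies `[x - p, x - p] = -‖x - p‖² ≤ 0`, so it vanishes. -/
theorem maximal_isPositiveSubspace_iff (hJ : IsFundamentalSymmetry J) {L : Submodule ℂ E} :
    Maximal (IsPositiveSubspace J) L ↔
      IsPositiveSubspace J L ∧ ∀ u, J u = u → (∀ p ∈ L, form J p u = 0) → u = 0 := by
  constructor
  · rintro ⟨hL, hmax⟩
    refine ⟨hL, fun u hu horth => by_contra fun hu0 => ?_⟩
    have hpos : 0 < (form J u u).re := by
      rw [form_self_re_of_apply_eq hu]
      positivity
    have hsup : IsPositiveSubspace J (L ⊔ ℂ ∙ u) := by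
      refine ⟨Submodule.isClosed_sup_finiteDimensional _ _ hL.isClosed, ?_⟩
      intro f hf hf0
      obtain ⟨p, hp, v, hv, rfl⟩ := Submodule.mem_sup.1 hf
      obtain ⟨c, rfl⟩ := Submodule.mem_span_singleton.1 hv
      have h1 : form J p (c • u) = 0 := by
        rw [form, inner_smul_left]
        exact mul_eq_zero_of_right _ (horth p hp)
      have h2 : (form J (c • u) (c • u)).re = ‖c‖ ^ 2 * (form J u u).re := by
        rw [form_self_re_of_apply_eq hu, form_self_re_of_apply_eq (by rw [map_smul, hu]),
          norm_smul, mul_pow]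
      rw [form_add_left, form_add_right, form_add_right, h1, hJ.form_eq_zero_comm h1, add_zero,
        zero_add, Complex.add_re, h2]
      rcases eq_or_ne p 0 with rfl | hp0
      · have hc : c ≠ 0 := by
          rintro rfl
          simp at hf0
        have := mul_pos (pow_pos (norm_pos_iff.2 hc) 2) hpos
        simpa [form] using this
      · have := mul_nonneg (sq_nonneg ‖c‖) hpos.le
        linarith [hL.pos p hp hp0]
    have huL : u ∈ L := hmax hsup le_sup_left
      (Submodule.mem_sup_right (Submodule.mem_span_singleton_self u))
    rw [horth u huL] at hpos
    exact lt_irrefl _ hpos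
  · rintro ⟨hL, h⟩
    refine ⟨hL, fun M hM hLM x hx => ?_⟩
    obtain ⟨p, hp, hxp⟩ := hL.exists_sub_apply_eq_neg hJ h x
    have h0 : x - p = 0 := by
      refine hM.eq_zero (M.sub_mem hx (hLM hp)) ?_
      rw [form_self_re_of_apply_eq_neg hxp]
      exact neg_nonpos.2 (sq_nonneg _)
    rwa [sub_eq_zero.1 h0]

theorem maximal_isNegativeSubspace_iff (hJ : IsFundamentalSymmetry J) {L : Submodule ℂ E} :
    Maximal (IsNegativeSubspace J) L ↔
      IsNegativeSubspace J L ∧ ∀ u, J u = -u → (∀ p ∈ L, form J p u = 0) → u = 0 := by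
  rw [← isPositiveSubspace_neg, maximal_isPositiveSubspace_iff hJ.neg]
  simp [form_neg_operator, neg_eq_iff_eq_neg]

/-- For `J`-orthogonal maximal subspaces, `L₋` contains the `J`-orthogonal complement of `L₊`. -/
theorem mem_of_form_eq_zero (hJ : IsFundamentalSymmetry J) {Lp Lm : Submodule ℂ E}
    (hp : Maximal (IsPositiveSubspace J) Lp) (hm : Maximal (IsNegativeSubspace J) Lm)
    (horth : JOrthogonal J Lp Lm) {x : E} (hx : ∀ p ∈ Lp, form J p x = 0) : x ∈ Lm := by
  rw [← isPositiveSubspace_neg] at hm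
  obtain ⟨hm1, hm2⟩ := (maximal_isPositiveSubspace_iff hJ.neg).1 hm
  -- For `-J` this puts `x - m` in `ker (J - 1)`, where the maximality test for `L₊` applies.
  obtain ⟨m, hmL, hxm⟩ := hm1.exists_sub_apply_eq_neg hJ.neg hm2 x
  have h0 : x - m = 0 := by
    refine ((maximal_isPositiveSubspace_iff hJ).1 hp).2 _ (neg_injective hxm) fun p hpL => ?_
    rw [form_sub_right, hx p hpL, horth p hpL m hmL, sub_zero]
  rwa [sub_eq_zero.1 h0]

theorem mem_of_form_eq_zero' (hJ : IsFundamentalSymmetry J) {Lp Lm : Submodule ℂ E}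
    (hp : Maximal (IsPositiveSubspace J) Lp) (hm : Maximal (IsNegativeSubspace J) Lm)
    (horth : JOrthogonal J Lp Lm) {x : E} (hx : ∀ m ∈ Lm, form J m x = 0) : x ∈ Lp := by
  refine mem_of_form_eq_zero (J := -J) (Lp := Lm) hJ.neg ?_ ?_ (horth.symm hJ).neg fun m hm => ?_
  · rwa [isPositiveSubspace_neg]
  · rwa [← isPositiveSubspace_neg, neg_neg]
  · rw [form_neg_operator, hx m hm, neg_zero]

end FundamentalSymmetry

/-! ### From pairs of subspaces to operators. -/

section GOperator

theorem gOp_domain (J : E →L[ℂ] E) (Lp Lm : Submodule ℂ E) : (gOp J Lp Lm).domain = Lp ⊔ Lm :=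
  cOp_domain Lp Lm

theorem gOp_apply {Lp Lm : Submodule ℂ E} (h : Disjoint Lp Lm) {p m : E} (hp : p ∈ Lp)
    (hm : m ∈ Lm) (hpm : p + m ∈ (gOp J Lp Lm).domain) :
    gOp J Lp Lm ⟨p + m, hpm⟩ = J (p - m) :=
  congrArg J (cOp_apply h hp hm hpm)

theorem exists_add_eq_of_gOp_domain {Lp Lm : Submodule ℂ E} (f : (gOp J Lp Lm).domain) :
    ∃ p ∈ Lp, ∃ m ∈ Lm, p + m = f :=
  Submodule.mem_sup.1 ((gOp_domain J Lp Lm).le f.2)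

theorem gOp_eq {Lp Lm : Submodule ℂ E} (h : Disjoint Lp Lm) {p m : E} (hp : p ∈ Lp)
    (hm : m ∈ Lm) (f : (gOp J Lp Lm).domain) (hf : p + m = f) : gOp J Lp Lm f = J (p - m) := by
  obtain ⟨f, hfd⟩ := f
  obtain rfl : p + m = f := hf
  exact gOp_apply h hp hm hfd

theorem gOp_le {Lp0 Lm0 : Submodule ℂ E} (h : Disjoint Lp0 Lm0) {G : E →ₗ.[ℂ] E}
    (hp : ∀ p ∈ Lp0, ∃ hd : p ∈ G.domain, G ⟨p, hd⟩ = J p)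
    (hm : ∀ m ∈ Lm0, ∃ hd : m ∈ G.domain, G ⟨m, hd⟩ = -J m) : gOp J Lp0 Lm0 ≤ G := by
  refine ⟨?_, ?_⟩
  · rw [gOp_domain]
    exact sup_le (fun p hp' => (hp p hp').1) (fun m hm' => (hm m hm').1)
  · intro x y hxy
    obtain ⟨p, hpL, m, hmL, hpm⟩ := exists_add_eq_of_gOp_domain x
    obtain ⟨hpd, hGp⟩ := hp p hpL
    obtain ⟨hmd, hGm⟩ := hm m hmL
    have hy : y = ⟨p, hpd⟩ + ⟨m, hmd⟩ := Subtype.ext (by simp [← hxy, hpm])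
    rw [gOp_eq h hpL hmL x hpm, hy, LinearPMap.map_add, hGp, hGm, map_sub, sub_eq_add_neg]

theorem gOp_apply_left {Lp Lm : Submodule ℂ E} (h : Disjoint Lp Lm) {p : E} (hp : p ∈ Lp) :
    ∃ hd : p ∈ (gOp J Lp Lm).domain, gOp J Lp Lm ⟨p, hd⟩ = J p :=
  have hd : p ∈ (gOp J Lp Lm).domain := (gOp_domain J Lp Lm) ▸ Submodule.mem_sup_left hp
  ⟨hd, by simpa using gOp_eq h hp Lm.zero_mem ⟨p, hd⟩ (add_zero p)⟩

theorem gOp_apply_right {Lp Lm : Submodule ℂ E} (h : Disjoint Lp Lm) {m : E} (hm : m ∈ Lm) :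
    ∃ hd : m ∈ (gOp J Lp Lm).domain, gOp J Lp Lm ⟨m, hd⟩ = -J m :=
  have hd : m ∈ (gOp J Lp Lm).domain := (gOp_domain J Lp Lm) ▸ Submodule.mem_sup_right hm
  ⟨hd, by simpa using gOp_eq h Lp.zero_mem hm ⟨m, hd⟩ (zero_add m)⟩

variable [CompleteSpace E]

theorem satisfiesJGJG_gOp (hJ : IsFundamentalSymmetry J) {Lp Lm : Submodule ℂ E}
    (h : Disjoint Lp Lm) : SatisfiesJGJG J (gOp J Lp Lm) := by
  intro f
  obtain ⟨p, hp, m, hm, hpm⟩ := exists_add_eq_of_gOp_domain f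
  have hGf : J (gOp J Lp Lm f) = p - m := by rw [gOp_eq h hp hm f hpm, hJ.apply_apply]
  have hd : J (gOp J Lp Lm f) ∈ (gOp J Lp Lm).domain := by
    rw [hGf, gOp_domain]
    exact Submodule.sub_mem _ (Submodule.mem_sup_left hp) (Submodule.mem_sup_right hm)
  refine ⟨hd, ?_⟩
  rw [gOp_eq h hp (Lm.neg_mem hm) ⟨_, hd⟩ (by simp [hGf, sub_eq_add_neg]), hJ.apply_apply,
    sub_neg_eq_add, hpm]

/-- By J-orthogonality the cross terms vanish: `(G(p + m), p + m) = [p, p] - [m, m]`. -/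
theorem isPositiveOperator_gOp (hJ : IsFundamentalSymmetry J) {Lp Lm : Submodule ℂ E}
    (hp : IsPositiveSubspace J Lp) (hm : IsNegativeSubspace J Lm) (horth : JOrthogonal J Lp Lm) :
    IsPositiveOperator (gOp J Lp Lm) := by
  intro f hf
  have h := disjoint_of_isPositiveSubspace_of_isNegativeSubspace hp hm
  obtain ⟨p, hpL, m, hmL, hpm⟩ := exists_add_eq_of_gOp_domain f
  have hform : inner ℂ (f : E) (gOp J Lp Lm f) = form J p p - form J m m := by
    rw [gOp_eq h hpL hmL f hpm, ← hpm]
    change form J (p - m) (p + m) = _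
    rw [form_sub_left, form_add_right, form_add_right, horth p hpL m hmL,
      hJ.form_eq_zero_comm (horth p hpL m hmL), add_zero, zero_add]
  rw [hform, Complex.sub_re]
  rcases eq_or_ne p 0 with rfl | hp0
  · have hm0 : m ≠ 0 := by
      rintro rfl
      exact hf (by rw [← hpm, add_zero])
    linarith [hp.nonneg hpL, hm.neg m hmL hm0]
  · have := (isPositiveSubspace_neg_iff.2 hm).nonneg hmL
    rw [form_neg_operator, Complex.neg_re] at this
    linarith [hp.pos p hpL hp0]

theorem isFormalAdjoint_gOp (hJ : IsFundamentalSymmetry J) {Lp Lm : Submodule ℂ E}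
    (h : Disjoint Lp Lm) (horth : JOrthogonal J Lp Lm) :
    (gOp J Lp Lm).IsFormalAdjoint (gOp J Lp Lm) := by
  intro f g
  obtain ⟨p, hp, m, hm, hpm⟩ := exists_add_eq_of_gOp_domain f
  obtain ⟨p', hp', m', hm', hpm'⟩ := exists_add_eq_of_gOp_domain g
  rw [gOp_eq h hp hm f hpm, gOp_eq h hp' hm' g hpm', ← hpm, ← hpm', hJ.inner_apply_left]
  change form J (p' + m') (p - m) = form J (p' - m') (p + m)
  simp only [form_add_left, form_sub_left, form_add_right, form_sub_right, horth p' hp' m hm,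
    hJ.form_eq_zero_comm (horth p hp m' hm')]
  ring

/-- If `u` is orthogonal to the domain, `J u` is J-orthogonal to both subspaces, hence lies in both,
hence is zero. -/
theorem dense_gOp_domain (hJ : IsFundamentalSymmetry J) {Lp Lm : Submodule ℂ E}
    (hp : Maximal (IsPositiveSubspace J) Lp) (hm : Maximal (IsNegativeSubspace J) Lm)
    (horth : JOrthogonal J Lp Lm) : Dense ((gOp J Lp Lm).domain : Set E) := by
  have h := disjoint_of_isPositiveSubspace_of_isNegativeSubspace hp.prop hm.prop
  rw [Submodule.dense_iff_topologicalClosure_eq_top,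
    Submodule.topologicalClosure_eq_top_iff, Submodule.eq_bot_iff]
  intro u hu
  have key : ∀ x ∈ Lp ⊔ Lm, form J x (J u) = 0 := by
    intro x hx
    rw [form, hJ.inner_apply_left, hJ.apply_apply]
    exact (Submodule.mem_orthogonal' _ _).1 hu x ((gOp_domain J Lp Lm).symm ▸ hx)
  have h0 : J u = 0 := Submodule.disjoint_def.1 h _
    (mem_of_form_eq_zero' hJ hp hm horth fun m hm => key m (Submodule.mem_sup_right hm))
    (mem_of_form_eq_zero hJ hp hm horth fun p hp => key p (Submodule.mem_sup_left hp))
  rw [← hJ.apply_apply u, h0, map_zero]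

theorem isSelfAdjoint_gOp (hJ : IsFundamentalSymmetry J) {Lp Lm : Submodule ℂ E}
    (hp : Maximal (IsPositiveSubspace J) Lp) (hm : Maximal (IsNegativeSubspace J) Lm)
    (horth : JOrthogonal J Lp Lm) : IsSelfAdjoint (gOp J Lp Lm) := by
  have h := disjoint_of_isPositiveSubspace_of_isNegativeSubspace hp.prop hm.prop
  have hdense := dense_gOp_domain hJ hp hm horth
  have hle := LinearPMap.IsFormalAdjoint.le_adjoint hdense (isFormalAdjoint_gOp hJ h horth)
  rw [LinearPMap.isSelfAdjoint_def]
  refine (LinearPMap.eq_of_le_of_domain_eq hle (le_antisymm hle.1 fun g hg => ?_)).symm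
  -- The vector `k = J G* g` plays the role of `C g`: then `g + k` and `g - k` should be twice the
  -- components of `g` in `L₊` and `L₋`.
  set k : E := J ((gOp J Lp Lm).adjoint ⟨g, hg⟩) with hk
  have key : ∀ x : (gOp J Lp Lm).domain, form J (x : E) k = inner ℂ g (gOp J Lp Lm x) := by
    intro x
    rw [form, hk, hJ.inner_apply_left, hJ.apply_apply]
    exact LinearPMap.adjoint_isFormalAdjoint hdense ⟨g, hg⟩ x
  have h1 : g - k ∈ Lm := mem_of_form_eq_zero hJ hp hm horth fun p hpL => by
    obtain ⟨hd, hG⟩ := gOp_apply_left (J := J) h hpL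
    rw [form_sub_right, key ⟨p, hd⟩, hG, form, sub_self]
  have h2 : g + k ∈ Lp := mem_of_form_eq_zero' hJ hp hm horth fun m hmL => by
    obtain ⟨hd, hG⟩ := gOp_apply_right (J := J) h hmL
    rw [form_add_right, key ⟨m, hd⟩, hG, form, inner_neg_right, add_neg_cancel]
  have h3 : g = (1 / 2 : ℂ) • ((g + k) + (g - k)) := by module
  rw [gOp_domain, h3]
  exact Submodule.smul_mem _ _
    (Submodule.add_mem _ (Submodule.mem_sup_left h2) (Submodule.mem_sup_right h1))

end GOperator

/-! ### From operators to pairs of subspaces. -/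

section RangePair

variable {G : E →ₗ.[ℂ] E}

/-- Since `J G` is an involution of `D(G)`, `½ (I + J G)` is the projection to its eigenspace for
the eigenvalue 1. -/
theorem mem_rangePair_fst_iff (hG : SatisfiesJGJG J G) {x : E} :
    x ∈ (rangePair J G).1 ↔ ∃ hd : x ∈ G.domain, J (G ⟨x, hd⟩) = x := by
  constructor
  · rintro ⟨f, rfl⟩
    obtain ⟨h, hf⟩ := hG f
    have hx : ((1 / 2 : ℂ) • (G.domain.subtype + (J : E →ₗ[ℂ] E) ∘ₗ G.toFun)) f =
        ((1 / 2 : ℂ) • (f + ⟨J (G f), h⟩ : G.domain) : G.domain) := rfl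
    rw [hx]
    refine ⟨Subtype.coe_prop _, ?_⟩
    rw [Subtype.coe_eta, LinearPMap.map_smul, LinearPMap.map_add, map_smul, map_add, hf, add_comm]
    rfl
  · rintro ⟨hd, hx⟩
    refine ⟨⟨x, hd⟩, ?_⟩
    change (1 / 2 : ℂ) • (x + J (G ⟨x, hd⟩)) = x
    rw [hx]
    module

theorem mem_rangePair_snd_iff (hG : SatisfiesJGJG J G) {x : E} :
    x ∈ (rangePair J G).2 ↔ ∃ hd : x ∈ G.domain, J (G ⟨x, hd⟩) = -x := by
  constructor
  · rintro ⟨f, rfl⟩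
    obtain ⟨h, hf⟩ := hG f
    have hx : ((1 / 2 : ℂ) • (G.domain.subtype - (J : E →ₗ[ℂ] E) ∘ₗ G.toFun)) f =
        ((1 / 2 : ℂ) • (f - ⟨J (G f), h⟩ : G.domain) : G.domain) := rfl
    rw [hx]
    refine ⟨Subtype.coe_prop _, ?_⟩
    rw [Subtype.coe_eta, LinearPMap.map_smul, LinearPMap.map_sub, map_smul, map_sub, hf,
      Submodule.coe_smul, Submodule.coe_sub, ← smul_neg, neg_sub]
  · rintro ⟨hd, hx⟩
    refine ⟨⟨x, hd⟩, ?_⟩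
    change (1 / 2 : ℂ) • (x - J (G ⟨x, hd⟩)) = x
    rw [hx]
    module

/-- Every `f ∈ D(G)` splits as `½ (f + J G f) + ½ (f - J G f)`. -/
theorem exists_add_eq_of_mem_domain (f : G.domain) :
    ∃ p ∈ (rangePair J G).1, ∃ m ∈ (rangePair J G).2, p + m = f := by
  refine ⟨_, ⟨f, rfl⟩, _, ⟨f, rfl⟩, ?_⟩
  change (1 / 2 : ℂ) • ((f : E) + J (G f)) + (1 / 2 : ℂ) • ((f : E) - J (G f)) = f
  module

variable [CompleteSpace E]

theorem apply_eq_of_mem_rangePair_fst (hJ : IsFundamentalSymmetry J) (hG : SatisfiesJGJG J G)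
    {p : E} (hp : p ∈ (rangePair J G).1) : ∃ hd : p ∈ G.domain, G ⟨p, hd⟩ = J p := by
  obtain ⟨hd, h⟩ := (mem_rangePair_fst_iff hG).1 hp
  exact ⟨hd, by rw [← hJ.apply_apply (G ⟨p, hd⟩), h]⟩

theorem apply_eq_of_mem_rangePair_snd (hJ : IsFundamentalSymmetry J) (hG : SatisfiesJGJG J G)
    {m : E} (hm : m ∈ (rangePair J G).2) : ∃ hd : m ∈ G.domain, G ⟨m, hd⟩ = -J m := by
  obtain ⟨hd, h⟩ := (mem_rangePair_snd_iff hG).1 hm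
  exact ⟨hd, by rw [← hJ.apply_apply (G ⟨m, hd⟩), h, map_neg]⟩

theorem isPositiveSubspace_rangePair_fst (hJ : IsFundamentalSymmetry J)
    (hG : SatisfiesJGJG J G) (hself : IsSelfAdjoint G) (hpos : IsPositiveOperator G) :
    IsPositiveSubspace J (rangePair J G).1 := by
  refine ⟨?_, fun f hf h0 => ?_⟩
  -- The subspace is where `G` agrees with the bounded operator `J`, and the graph of `G` is closed.
  · have hset : ((rangePair J G).1 : Set E) = (fun x : E => (x, J x)) ⁻¹' (G.graph : Set (E × E)) := by
      ext x
      simp only [SetLike.mem_coe, Set.mem_preimage, LinearPMap.mem_graph_iff]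
      constructor
      · intro hx
        obtain ⟨hd, h⟩ := apply_eq_of_mem_rangePair_fst hJ hG hx
        exact ⟨⟨x, hd⟩, rfl, h⟩
      · rintro ⟨⟨y, hd⟩, rfl, h⟩
        exact (mem_rangePair_fst_iff hG).2 ⟨hd, by rw [h, hJ.apply_apply]⟩
    rw [hset]
    exact IsClosed.preimage (by fun_prop) hself.isClosed
  · obtain ⟨hd, h⟩ := apply_eq_of_mem_rangePair_fst hJ hG hf
    have := hpos ⟨f, hd⟩ h0
    rwa [h] at this

theorem isNegativeSubspace_rangePair_snd (hJ : IsFundamentalSymmetry J)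
    (hG : SatisfiesJGJG J G) (hself : IsSelfAdjoint G) (hpos : IsPositiveOperator G) :
    IsNegativeSubspace J (rangePair J G).2 := by
  refine ⟨?_, fun f hf h0 => ?_⟩
  · have hset : ((rangePair J G).2 : Set E) =
        (fun x : E => (x, -J x)) ⁻¹' (G.graph : Set (E × E)) := by
      ext x
      simp only [SetLike.mem_coe, Set.mem_preimage, LinearPMap.mem_graph_iff]
      constructor
      · intro hx
        obtain ⟨hd, h⟩ := apply_eq_of_mem_rangePair_snd hJ hG hx
        exact ⟨⟨x, hd⟩, rfl, h⟩
      · rintro ⟨⟨y, hd⟩, rfl, h⟩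
        exact (mem_rangePair_snd_iff hG).2 ⟨hd, by rw [h, map_neg, hJ.apply_apply]⟩
    rw [hset]
    exact IsClosed.preimage (by fun_prop) hself.isClosed
  · obtain ⟨hd, h⟩ := apply_eq_of_mem_rangePair_snd hJ hG hf
    have := hpos ⟨f, hd⟩ h0
    rw [h, inner_neg_right, Complex.neg_re] at this
    exact neg_pos.1 this

theorem inner_apply_of_isSelfAdjoint (hself : IsSelfAdjoint G) (f g : G.domain) :
    inner ℂ (G f) (g : E) = inner ℂ (f : E) (G g) := by
  have h := LinearPMap.adjoint_isFormalAdjoint hself.dense_domain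
  rw [LinearPMap.isSelfAdjoint_def.1 hself] at h
  exact h f g

/-- The hypothesis says that `u ∈ D(G*)` with `G* u = w`; this is how vectors are shown to lie in
`D(G)`. -/
theorem apply_eq_of_inner_eq (hself : IsSelfAdjoint G) {u w : E}
    (h : ∀ f : G.domain, inner ℂ w (f : E) = inner ℂ u (G f)) :
    ∃ hd : u ∈ G.domain, G ⟨u, hd⟩ = w := by
  have hd := LinearPMap.mem_adjoint_domain_of_exists u ⟨w, h⟩
  have hw := LinearPMap.adjoint_apply_eq hself.dense_domain ⟨u, hd⟩ h
  have hmem : (u, w) ∈ G.adjoint.graph := (LinearPMap.mem_graph_iff _).2 ⟨⟨u, hd⟩, rfl, hw⟩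
  rw [LinearPMap.isSelfAdjoint_def.1 hself, LinearPMap.mem_graph_iff] at hmem
  obtain ⟨⟨y, hy⟩, rfl, h2⟩ := hmem
  exact ⟨hy, h2⟩

theorem jOrthogonal_rangePair (hJ : IsFundamentalSymmetry J) (hG : SatisfiesJGJG J G)
    (hself : IsSelfAdjoint G) : JOrthogonal J (rangePair J G).1 (rangePair J G).2 := by
  intro p hp m hm
  obtain ⟨hpd, hGp⟩ := apply_eq_of_mem_rangePair_fst hJ hG hp
  obtain ⟨hmd, hGm⟩ := apply_eq_of_mem_rangePair_snd hJ hG hm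
  have h := inner_apply_of_isSelfAdjoint hself ⟨m, hmd⟩ ⟨p, hpd⟩
  rw [hGp, hGm, inner_neg_left, hJ.inner_apply_left, neg_eq_iff_add_eq_zero, ← two_mul] at h
  exact (mul_eq_zero.1 h).resolve_left two_ne_zero

/-- If `J u = u` and `u` is J-orthogonal to `L₊`, then `(u, G f) = (-u, f)` on `D(G)`, so
self-adjointness gives `G u = -u`. Thus `J G u = -u` and `u ∈ L₋`, yet `[u, u] = ‖u‖² ≥ 0`; hence `u
= 0`. -/
theorem maximal_rangePair_fst (hJ : IsFundamentalSymmetry J) (hG : SatisfiesJGJG J G)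
    (hself : IsSelfAdjoint G) (hpos : IsPositiveOperator G) :
    Maximal (IsPositiveSubspace J) (rangePair J G).1 := by
  refine (maximal_isPositiveSubspace_iff hJ).2
    ⟨isPositiveSubspace_rangePair_fst hJ hG hself hpos, fun u hu horth => ?_⟩
  have hGu : ∃ hd : u ∈ G.domain, G ⟨u, hd⟩ = -u := by
    refine apply_eq_of_inner_eq hself fun f => ?_
    obtain ⟨p, hp, m, hm, hpm⟩ := exists_add_eq_of_mem_domain (J := J) f
    obtain ⟨hpd, hGp⟩ := apply_eq_of_mem_rangePair_fst hJ hG hp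
    obtain ⟨hmd, hGm⟩ := apply_eq_of_mem_rangePair_snd hJ hG hm
    have hf : f = ⟨p, hpd⟩ + ⟨m, hmd⟩ := Subtype.ext hpm.symm
    have h1 : inner ℂ u (J p) = 0 := horth p hp
    have h2 : inner ℂ u p = 0 := by rw [← h1, ← hJ.inner_apply_left, hu]
    have h3 : inner ℂ u (J m) = inner ℂ u m := by rw [← hJ.inner_apply_left, hu]
    rw [hf, LinearPMap.map_add, hGp, hGm, inner_add_right, h1, inner_neg_right, h3,
      Submodule.coe_add, inner_neg_left, inner_add_right, h2]
    ring
  obtain ⟨hd, h⟩ := hGu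
  by_contra h0
  have := (isNegativeSubspace_rangePair_snd hJ hG hself hpos).neg u
    ((mem_rangePair_snd_iff hG).2 ⟨hd, by rw [h, map_neg, hu]⟩) h0
  rw [form_self_re_of_apply_eq hu] at this
  exact this.not_ge (sq_nonneg _)

theorem maximal_rangePair_snd (hJ : IsFundamentalSymmetry J) (hG : SatisfiesJGJG J G)
    (hself : IsSelfAdjoint G) (hpos : IsPositiveOperator G) :
    Maximal (IsNegativeSubspace J) (rangePair J G).2 := by
  refine (maximal_isNegativeSubspace_iff hJ).2
    ⟨isNegativeSubspace_rangePair_snd hJ hG hself hpos, fun u hu horth => ?_⟩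
  have hGu : ∃ hd : u ∈ G.domain, G ⟨u, hd⟩ = -u := by
    refine apply_eq_of_inner_eq hself fun f => ?_
    obtain ⟨p, hp, m, hm, hpm⟩ := exists_add_eq_of_mem_domain (J := J) f
    obtain ⟨hpd, hGp⟩ := apply_eq_of_mem_rangePair_fst hJ hG hp
    obtain ⟨hmd, hGm⟩ := apply_eq_of_mem_rangePair_snd hJ hG hm
    have hf : f = ⟨p, hpd⟩ + ⟨m, hmd⟩ := Subtype.ext hpm.symm
    have h1 : inner ℂ u (J m) = 0 := horth m hm
    have h2 : inner ℂ u m = 0 := by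
      rw [← neg_eq_zero, ← inner_neg_left, ← hu, hJ.inner_apply_left, h1]
    have h3 : inner ℂ u (J p) = -inner ℂ u p := by
      rw [← hJ.inner_apply_left, hu, inner_neg_left]
    rw [hf, LinearPMap.map_add, hGp, hGm, inner_add_right, inner_neg_right, h1, h3,
      Submodule.coe_add, inner_neg_left, inner_add_right, h2]
    ring
  obtain ⟨hd, h⟩ := hGu
  by_contra h0
  have := (isPositiveSubspace_rangePair_fst hJ hG hself hpos).pos u
    ((mem_rangePair_fst_iff hG).2 ⟨hd, by rw [h, map_neg, hu, neg_neg]⟩) h0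
  rw [form_self_re_of_apply_eq_neg hu] at this
  exact this.not_ge (neg_nonpos.2 (sq_nonneg _))

theorem rangePair_gOp (hJ : IsFundamentalSymmetry J) {Lp Lm : Submodule ℂ E}
    (h : Disjoint Lp Lm) : rangePair J (gOp J Lp Lm) = (Lp, Lm) := by
  have hG := satisfiesJGJG_gOp hJ h
  refine Prod.ext (Submodule.ext fun x => ?_) (Submodule.ext fun x => ?_)
  · rw [mem_rangePair_fst_iff hG]
    constructor
    · rintro ⟨hd, hx⟩
      obtain ⟨p, hp, m, hm, hpm⟩ := exists_add_eq_of_gOp_domain ⟨x, hd⟩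
      rw [gOp_eq h hp hm _ hpm, hJ.apply_apply] at hx
      have hpm' : p + m = x := hpm
      -- From `p - m = x` and `p + m = x`, averaging gives `x = p`.
      have : x = p := by
        have h2 : x = (1 / 2 : ℂ) • (x + x) := by module
        rw [h2]
        nth_rw 1 [← hx]
        rw [← hpm']
        module
      exact this ▸ hp
    · intro hx
      obtain ⟨hd, hGx⟩ := gOp_apply_left (J := J) h hx
      exact ⟨hd, by rw [hGx, hJ.apply_apply]⟩
  · rw [mem_rangePair_snd_iff hG]
    constructor
    · rintro ⟨hd, hx⟩
      obtain ⟨p, hp, m, hm, hpm⟩ := exists_add_eq_of_gOp_domain ⟨x, hd⟩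
      rw [gOp_eq h hp hm _ hpm, hJ.apply_apply] at hx
      have hpm' : p + m = x := hpm
      have : x = m := by
        have h2 : x = (1 / 2 : ℂ) • (x - -x) := by module
        rw [h2, ← hx, ← hpm']
        module
      exact this ▸ hm
    · intro hx
      obtain ⟨hd, hGx⟩ := gOp_apply_right (J := J) h hx
      exact ⟨hd, by rw [hGx, map_neg, hJ.apply_apply]⟩

theorem gOp_rangePair (hJ : IsFundamentalSymmetry J) (hG : SatisfiesJGJG J G)
    (h : Disjoint (rangePair J G).1 (rangePair J G).2) :
    gOp J (rangePair J G).1 (rangePair J G).2 = G := by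
  have hle : gOp J (rangePair J G).1 (rangePair J G).2 ≤ G :=
    gOp_le h (fun _ hp => apply_eq_of_mem_rangePair_fst hJ hG hp)
      (fun _ hm => apply_eq_of_mem_rangePair_snd hJ hG hm)
  refine LinearPMap.eq_of_le_of_domain_eq hle (le_antisymm hle.1 fun f hf => ?_)
  rw [gOp_domain, Submodule.mem_sup]
  exact exists_add_eq_of_mem_domain ⟨f, hf⟩

/-! ### The correspondence of extensions. -/

theorem mapsTo_gOp (hJ : IsFundamentalSymmetry J) {Lp0 Lm0 : Submodule ℂ E}
    (h0 : Disjoint Lp0 Lm0) :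
    Set.MapsTo (fun L : Submodule ℂ E × Submodule ℂ E => gOp J L.1 L.2)
      (maximalExtensions J Lp0 Lm0) (positiveExtensions J (gOp J Lp0 Lm0)) := by
  rintro ⟨Lp, Lm⟩ ⟨hp0, hm0, hp, hm, horth⟩
  have h := disjoint_of_isPositiveSubspace_of_isNegativeSubspace hp.prop hm.prop
  exact ⟨gOp_le h0 (fun p hpL => gOp_apply_left h (hp0 hpL))
      (fun m hmL => gOp_apply_right h (hm0 hmL)),
    isSelfAdjoint_gOp hJ hp hm horth, isPositiveOperator_gOp hJ hp.prop hm.prop horth,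
    satisfiesJGJG_gOp hJ h⟩

theorem mapsTo_rangePair (hJ : IsFundamentalSymmetry J) {Lp0 Lm0 : Submodule ℂ E}
    (h0 : Disjoint Lp0 Lm0) :
    Set.MapsTo (rangePair J) (positiveExtensions J (gOp J Lp0 Lm0))
      (maximalExtensions J Lp0 Lm0) := by
  rintro G ⟨hle, hself, hpos, hG⟩
  refine ⟨fun p hp => ?_, fun m hm => ?_, maximal_rangePair_fst hJ hG hself hpos,
    maximal_rangePair_snd hJ hG hself hpos, jOrthogonal_rangePair hJ hG hself⟩
  · obtain ⟨hd, hGp⟩ := gOp_apply_left (J := J) h0 hp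
    refine (mem_rangePair_fst_iff hG).2 ⟨hle.1 hd, ?_⟩
    rw [← hle.2 (x := ⟨p, hd⟩) rfl, hGp, hJ.apply_apply]
  · obtain ⟨hd, hGm⟩ := gOp_apply_right (J := J) h0 hm
    refine (mem_rangePair_snd_iff hG).2 ⟨hle.1 hd, ?_⟩
    rw [← hle.2 (x := ⟨m, hd⟩) rfl, hGm, map_neg, hJ.apply_apply]

end RangePair

end KreinC

theorem proposition2 {E : Type*} [NormedAddCommGroup E] [InnerProductSpace ℂ E] [CompleteSpace E]
    (J : E →L[ℂ] E) (hJ : KreinC.IsFundamentalSymmetry J)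
    (A : E →ₗ.[ℂ] E) (hA : KreinC.IsJSymmetric J A)
    {ι : Type*} (lam : ι → ℝ) (hlam : Function.Injective lam)
    (e : ι → A.domain) (he : ∀ n, (e n : E) ≠ 0) (heig : ∀ n, A (e n) = (lam n : ℂ) • (e n : E))
    (hcomplete : Dense (Submodule.span ℂ (Set.range fun n => (e n : E)) : Set E))
    (Lp0 Lm0 : Submodule ℂ E) (hLp0 : Lp0 = KreinC.posSpan J fun n => (e n : E))
    (hLm0 : Lm0 = KreinC.negSpan J fun n => (e n : E)) :
    Set.BijOn (fun L : Submodule ℂ E × Submodule ℂ E => KreinC.gOp J L.1 L.2)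
        (KreinC.maximalExtensions J Lp0 Lm0)
        (KreinC.positiveExtensions J (KreinC.gOp J Lp0 Lm0)) ∧
      Set.InvOn (KreinC.rangePair J) (fun L => KreinC.gOp J L.1 L.2)
        (KreinC.maximalExtensions J Lp0 Lm0)
        (KreinC.positiveExtensions J (KreinC.gOp J Lp0 Lm0)) := by
  have h0 : Disjoint Lp0 Lm0 := by
    rw [hLp0, hLm0]
    exact KreinC.disjoint_posSpan_negSpan hJ hA hlam heig hcomplete
  have hinv : Set.InvOn (KreinC.rangePair J) (fun L => KreinC.gOp J L.1 L.2)
      (KreinC.maximalExtensions J Lp0 Lm0)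
      (KreinC.positiveExtensions J (KreinC.gOp J Lp0 Lm0)) := by
    refine ⟨?_, ?_⟩
    · rintro ⟨Lp, Lm⟩ ⟨-, -, hp, hm, -⟩
      exact KreinC.rangePair_gOp hJ
        (KreinC.disjoint_of_isPositiveSubspace_of_isNegativeSubspace hp.prop hm.prop)
    · rintro G ⟨-, hself, hpos, hG⟩
      exact KreinC.gOp_rangePair hJ hG
        (KreinC.disjoint_of_isPositiveSubspace_of_isNegativeSubspace
          (KreinC.isPositiveSubspace_rangePair_fst hJ hG hself hpos)
          (KreinC.isNegativeSubspace_rangePair_snd hJ hG hself hpos))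
  exact ⟨hinv.bijOn (KreinC.mapsTo_gOp hJ h0) (KreinC.mapsTo_rangePair hJ h0), hinv⟩
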